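/- Let $\mathcal H$ be an infinite-dimensional separable complex Hilbert space. A sequence $\{f_i\}_{i\ge 1}$ in a closed subspace $\mathcal K\subseteq\mathcal H$ is a frame in $\mathcal K$ if there are constants $A,B>0$ with $A\|g\|^2\le\sum_{i}|\langle g,f_i\rangle|^2\le B\|g\|^2$ for all $g\in\mathcal K$; it is a Parseval frame in $\mathcal K$ if this holds with $A=B=1$. Its synthesis operator is the bounded operator $F:\ell^2\to\mathcal H$ with $Fe_i=f_i$ for all $i$, where $\{e_i\}$ is the standard basis of $\ell^2$. If $F=U|F|$ is the polar decomposition ($U$ a partial isometry with $\ker U=\ker F$), then $\{u_i\}=\{Ue_i\}$ is called the canonical Parseval frame of $\{f_i\}$. For orthogonal projections $P,Q$ on $\ell^2$ such that $QP|_{\mathrm{ran}\,P}:\mathrm{ran}\,P\to\mathrm{ran}\,Q$ is Fredholm, let $j(P,Q)$ be the index of this operator. Two sequences $\{f_i\},\{x_i\}$ in $\mathcal H$ are quadratically close if $\sum_i\|f_i-x_i\|^2<\infty$. Let $\mathcal F=\{f_i\}$ be a frame in a closed subspace $\mathcal K\subseteq\mathcal H$ with synthesis operator $F=U|F|$ and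 canonical Parseval frame $\{u_i\}$. Let $\mathcal Q_{\mathcal F}$ be the set of all Parseval frames $\{x_i\}$ in closed subspaces of $\mathcal H$ that are quadratically close to $\{f_i\}$, and let $\mathcal Q_{\mathcal F}^0$ be the set of those $\{x_i\}\in\mathcal Q_{\mathcal F}$ whose synthesis operator $X$ satisfies $j(U^*U,X^*X)=0$ (in particular, the operator defining the index is Fredholm). Theorem. Suppose that $\mathcal Q_{\mathcal F}\neq\emptyset$. Then $\{u_i\}\in\mathcal Q_{\mathcal F}^0$, and $$\sum_{i=1}^\infty\|f_i-u_i\|^2\le\sum_{i=1}^\infty\|f_i-x_i\|^2$$ for all $\{x_i\}\in\mathcal Q_{\mathcal F}^0$. Furthermore, equality holds if and only if $x_i=u_i$ for all $i$. -/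

import Mathlib

open scoped lp InnerProductSpace
open ContinuousLinearMap (adjoint)

namespace FrameApprox

section Operators

variable {E H : Type*}
  [NormedAddCommGroup E] [InnerProductSpace ℂ E] [CompleteSpace E]
  [NormedAddCommGroup H] [InnerProductSpace ℂ H] [CompleteSpace H]

/-- The modulus `|F| = (F* F)^(1/2)` of a bounded operator `F : E → H`. -/
noncomputable def modulus (F : E →L[ℂ] H) : E →L[ℂ] E :=
  CFC.sqrt (adjoint F ∘L F)

/-- `U` is the partially isometric factor of the polar decomposition of `F`: it is a partial
isometry (isometric on the orthogonal complement of its kernel), `F = U |F|` and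
`ker U = ker F`. -/
structure IsPolarFactor (F U : E →L[ℂ] H) : Prop where
  isometric : ∀ x ∈ (U.ker)ᗮ, ‖U x‖ = ‖x‖
  factor : F = U ∘L modulus F
  ker_eq : U.ker = F.ker

theorem modulus_nonneg (F : E →L[ℂ] H) : 0 ≤ modulus F := CFC.sqrt_nonneg _

theorem modulus_isSelfAdjoint (F : E →L[ℂ] H) : IsSelfAdjoint (modulus F) :=
  (modulus_nonneg F).isSelfAdjoint

theorem modulus_comp_modulus (F : E →L[ℂ] H) : modulus F ∘L modulus F = adjoint F ∘L F := by
  have h : 0 ≤ adjoint F ∘L F := by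
    rw [ContinuousLinearMap.nonneg_iff_isPositive]
    exact ContinuousLinearMap.isPositive_adjoint_comp_self F
  exact CFC.sqrt_mul_sqrt_self _ h

theorem norm_modulus_apply (F : E →L[ℂ] H) (x : E) : ‖modulus F x‖ = ‖F x‖ := by
  have h : ⟪modulus F x, modulus F x⟫_ℂ = ⟪F x, F x⟫_ℂ := by
    rw [← ContinuousLinearMap.adjoint_inner_left, ← ContinuousLinearMap.adjoint_inner_left F,
      ← ContinuousLinearMap.star_eq_adjoint, (modulus_isSelfAdjoint F).star_eq]
    exact congrArg (fun y => ⟪y, x⟫_ℂ) (congrArg (fun T : E →L[ℂ] E => T x)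
      (modulus_comp_modulus F))
  rw [inner_self_eq_norm_sq_to_K, inner_self_eq_norm_sq_to_K] at h
  have h2 : ‖modulus F x‖ ^ 2 = ‖F x‖ ^ 2 := by exact_mod_cast h
  exact (sq_eq_sq₀ (norm_nonneg _) (norm_nonneg _)).1 h2

theorem ker_modulus (F : E →L[ℂ] H) : (modulus F).ker = F.ker := by
  ext x
  simp only [LinearMap.mem_ker, ContinuousLinearMap.coe_coe]
  rw [← norm_eq_zero, norm_modulus_apply, norm_eq_zero]

theorem closure_range_modulus (F : E →L[ℂ] H) :
    (modulus F).range.topologicalClosure = (F.ker)ᗮ := by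
  rw [← ker_modulus, ContinuousLinearMap.orthogonal_ker, ← ContinuousLinearMap.star_eq_adjoint,
    (modulus_isSelfAdjoint F).star_eq]

/-- Existence and uniqueness of the polar decomposition. -/
theorem existsUnique_isPolarFactor (F : E →L[ℂ] H) : ∃! U : E →L[ℂ] H, IsPolarFactor F U := by
  set M : Submodule ℂ E := (modulus F).range.topologicalClosure with hM
  have hMF : M = (F.ker)ᗮ := closure_range_modulus F
  have hMc : IsClosed (M : Set E) := Submodule.isClosed_topologicalClosure _
  have : CompleteSpace M := hMc.completeSpace_coe
  have hMo : Mᗮ = F.ker := by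
    have : CompleteSpace F.ker := (ContinuousLinearMap.isClosed_ker F).completeSpace_coe
    rw [hMF, Submodule.orthogonal_orthogonal]
  have hmem : ∀ x, modulus F x ∈ M := fun x =>
    Submodule.le_topologicalClosure _ (LinearMap.mem_range_self _ x)
  let e : E →ₗ[ℂ] M := (modulus F).toLinearMap.codRestrict M hmem
  have he : ∀ x, ((e x : M) : E) = modulus F x := fun x => rfl
  have hd : DenseRange e := by
    intro y
    rw [Topology.IsEmbedding.subtypeVal.closure_eq_preimage_closure_image, Set.mem_preimage]
    have hy : (y : E) ∈ closure (((modulus F).range : Submodule ℂ E) : Set E) := y.2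
    refine closure_mono ?_ hy
    rintro _ ⟨x, rfl⟩
    exact ⟨e x, ⟨x, rfl⟩, rfl⟩
  have hn : ∀ x, ‖F.toLinearMap x‖ ≤ 1 * ‖e x‖ := by
    intro x
    rw [one_mul, ← Submodule.norm_coe, he, norm_modulus_apply]
    exact le_rfl
  let W : M →L[ℂ] H := F.toLinearMap.extendOfNorm e
  have hW : ∀ x, W (e x) = F x := fun x => LinearMap.extendOfNorm_eq hd ⟨1, hn⟩ x
  have hWn : ∀ y : M, ‖W y‖ = ‖y‖ := by
    intro y
    refine hd.induction_on (p := fun y => ‖W y‖ = ‖y‖) y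
      (isClosed_eq (by fun_prop) (by fun_prop)) ?_
    intro x
    rw [hW, ← Submodule.norm_coe, he, norm_modulus_apply]
  let U : E →L[ℂ] H := W ∘L M.orthogonalProjectionOnto
  have hUM : ∀ y : M, U y = W y := by
    intro y
    change W (M.orthogonalProjectionOnto (y : E)) = W y
    rw [Submodule.orthogonalProjectionOnto_mem_subspace_eq_self]
  have hUk : U.ker = F.ker := by
    rw [← hMo]
    ext x
    rw [LinearMap.mem_ker, ← Submodule.orthogonalProjectionOnto_eq_zero_iff]
    change W (M.orthogonalProjectionOnto x) = 0 ↔ _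
    rw [← norm_eq_zero, hWn, norm_eq_zero]
  refine ⟨U, ⟨?_, ?_, hUk⟩, ?_⟩
  · intro x hx
    rw [hUk, ← hMF] at hx
    rw [hUM ⟨x, hx⟩, hWn]
    rfl
  · ext x
    change F x = U (modulus F x)
    rw [← he, hUM, hW]
  · intro V hV
    have hVM : ∀ y : M, V y = W y := by
      intro y
      refine hd.induction_on (p := fun y : M => V y = W y) y
        (isClosed_eq (by fun_prop) (by fun_prop)) ?_
      intro x
      rw [hW, he]
      exact (congrArg (fun T : E →L[ℂ] H => T x) hV.factor).symm
    ext x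
    have hx : x - M.orthogonalProjectionOnto x ∈ V.ker := by
      rw [hV.ker_eq, ← hMo]
      exact Submodule.sub_starProjection_mem_orthogonal x
    have h0 : V (x - M.orthogonalProjectionOnto x) = 0 := hx
    rw [map_sub, sub_eq_zero] at h0
    rw [h0, hVM]
    rfl

/-- The partial isometry `U` of the polar decomposition `F = U |F|`, `ker U = ker F`. -/
noncomputable def polarFactor (F : E →L[ℂ] H) : E →L[ℂ] H :=
  (existsUnique_isPolarFactor F).choose

theorem polarFactor_spec (F : E →L[ℂ] H) : IsPolarFactor F (polarFactor F) :=
  (existsUnique_isPolarFactor F).choose_spec.1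

end Operators

section Index

variable {E : Type*} [NormedAddCommGroup E] [InnerProductSpace ℂ E]

/-- The operator `Q P|_{ran P} : ran P → ran Q`. -/
def pairOperator (P Q : E →L[ℂ] E) : P.range →L[ℂ] Q.range :=
  ((Q ∘L P) ∘L P.range.subtypeL).codRestrict Q.range fun x => ⟨P x, rfl⟩

/-- The pair `(P, Q)` is a Fredholm pair of index `j(P, Q) = k` (used for orthogonal
projections `P`, `Q`): `Q P|_{ran P} : ran P → ran Q` is a Fredholm operator, and
`dim ker - dim coker = k`. -/
def IsFredholmPairOfIndex (P Q : E →L[ℂ] E) (k : ℤ) : Prop :=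
  (pairOperator P Q).IsFredholm ∧ (pairOperator P Q).toLinearMap.index = k

end Index

section Frames

variable {H : Type*} [NormedAddCommGroup H] [InnerProductSpace ℂ H]

/-- `f` is a frame in the closed subspace `K`. -/
structure IsFrameIn (K : Submodule ℂ H) (f : ℕ → H) : Prop where
  isClosed : IsClosed (K : Set H)
  mem : ∀ i, f i ∈ K
  bounds : ∃ A B : ℝ, 0 < A ∧ 0 < B ∧ ∀ x ∈ K,
    Summable (fun i => ‖⟪x, f i⟫_ℂ‖ ^ 2) ∧
      A * ‖x‖ ^ 2 ≤ ∑' i, ‖⟪x, f i⟫_ℂ‖ ^ 2 ∧ ∑' i, ‖⟪x, f i⟫_ℂ‖ ^ 2 ≤ B * ‖x‖ ^ 2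

/-- `f` is a Parseval frame in the closed subspace `K`, i.e. a frame with bounds `A = B = 1`. -/
structure IsParsevalFrameIn (K : Submodule ℂ H) (f : ℕ → H) : Prop where
  isClosed : IsClosed (K : Set H)
  mem : ∀ i, f i ∈ K
  parseval : ∀ x ∈ K, HasSum (fun i => ‖⟪x, f i⟫_ℂ‖ ^ 2) (‖x‖ ^ 2)

theorem IsParsevalFrameIn.isFrameIn {K : Submodule ℂ H} {f : ℕ → H}
    (h : IsParsevalFrameIn K f) : IsFrameIn K f :=
  ⟨h.isClosed, h.mem, 1, 1, one_pos, one_pos, fun x hx =>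
    ⟨(h.parseval x hx).summable, by rw [(h.parseval x hx).tsum_eq, one_mul],
      by rw [(h.parseval x hx).tsum_eq, one_mul]⟩⟩

/-- Two sequences are quadratically close if `∑ ‖f i - g i‖² < ∞`. -/
def QuadraticallyClose (f g : ℕ → H) : Prop :=
  Summable fun i => ‖f i - g i‖ ^ 2

/-- The Parseval frames (in closed subspaces of `H`) which are quadratically close to `f`. -/
def closeParsevalFrames (f : ℕ → H) : Set (ℕ → H) :=
  {x | (∃ L : Submodule ℂ H, IsParsevalFrameIn L x) ∧ QuadraticallyClose f x}

/-- `F : ℓ² → H` is the synthesis operator of `f`: `F eᵢ = fᵢ` on the standard basis. -/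
def IsSynthesis (f : ℕ → H) (F : ℓ²(ℕ, ℂ) →L[ℂ] H) : Prop :=
  ∀ i, F (lp.single 2 i (1 : ℂ)) = f i

open Classical in
/-- The synthesis operator of `f`, that is the bounded operator `F : ℓ² → H` with `F eᵢ = fᵢ`
(with the value `0` if there is none, which does not happen for frames). -/
noncomputable def synthesis (f : ℕ → H) : ℓ²(ℕ, ℂ) →L[ℂ] H :=
  if h : ∃ F, IsSynthesis f F then h.choose else 0

theorem IsSynthesis.eq {f : ℕ → H} {F G : ℓ²(ℕ, ℂ) →L[ℂ] H}
    (hF : IsSynthesis f F) (hG : IsSynthesis f G) : F = G := by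
  refine lp.ext_continuousLinearMap (by simp) fun i => ?_
  ext
  exact (hF i).trans (hG i).symm

theorem IsFrameIn.isSynthesis [CompleteSpace H] {K : Submodule ℂ H} {f : ℕ → H}
    (h : IsFrameIn K f) : IsSynthesis f (synthesis f) := by
  have hex : ∃ F, IsSynthesis f F := by
    obtain ⟨A, B, -, hB, hK⟩ := h.bounds
    have : CompleteSpace K := h.isClosed.completeSpace_coe
    have hsum : ∀ x : K, Summable (fun i => ‖⟪f i, (x : H)⟫_ℂ‖ ^ 2) := fun x => by
      simpa only [norm_inner_symm (x : H)] using (hK x x.2).1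
    let T₀ : K →ₗ[ℂ] ℓ²(ℕ, ℂ) :=
      { toFun := fun x => ⟨fun i => ⟪f i, (x : H)⟫_ℂ,
          memℓp_gen (by simpa using hsum x)⟩
        map_add' := fun x y => by
          ext i
          exact inner_add_right _ _ _
        map_smul' := fun c x => by
          ext i
          exact inner_smul_right _ _ _ }
    have hT₀ : ∀ x i, T₀ x i = ⟪f i, (x : H)⟫_ℂ := fun _ _ => rfl
    let T : K →L[ℂ] ℓ²(ℕ, ℂ) := T₀.mkContinuous (Real.sqrt B) fun x => by
      refine le_of_sq_le_sq ?_ (by positivity)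
      have h1 := lp.norm_rpow_eq_tsum (p := 2) (by simp) (T₀ x)
      simp only [ENNReal.toReal_ofNat, Real.rpow_ofNat] at h1
      rw [h1, mul_pow, Real.sq_sqrt hB.le]
      simpa only [hT₀, norm_inner_symm (x : H), Submodule.coe_norm] using (hK x x.2).2.2
    refine ⟨K.subtypeL ∘L adjoint T, fun i => ?_⟩
    have h2 : adjoint T (lp.single 2 i (1 : ℂ)) = ⟨f i, h.mem i⟩ := by
      refine ext_inner_right ℂ fun v => ?_
      rw [ContinuousLinearMap.adjoint_inner_left, lp.inner_single_left]
      simp [T, hT₀]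
    change ((adjoint T (lp.single 2 i (1 : ℂ)) : K) : H) = f i
    rw [h2]
  rw [synthesis, dif_pos hex]
  exact hex.choose_spec

variable [CompleteSpace H]

/-- The canonical Parseval frame `uᵢ = U eᵢ` of a frame `f` with synthesis operator `F = U |F|`. -/
noncomputable def canonicalParseval (f : ℕ → H) : ℕ → H :=
  fun i => polarFactor (synthesis f) (lp.single 2 i (1 : ℂ))

/-- The component of index `k` of the set of Parseval frames quadratically close to `f`: those
whose synthesis operator `X` satisfies `j(U*U, X*X) = k`, where `U` is the partially isometric
polar factor of the synthesis operator of `f`. -/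
def closeParsevalFramesOfIndex (f : ℕ → H) (k : ℤ) : Set (ℕ → H) :=
  {x | x ∈ closeParsevalFrames f ∧
    IsFredholmPairOfIndex
      (adjoint (polarFactor (synthesis f)) ∘L polarFactor (synthesis f))
      (adjoint (synthesis x) ∘L synthesis x) k}

end Frames

end FrameApprox

namespace FrameApprox

/-! ### Hilbert–Schmidt sums, compactness and diagonalization. -/

section HilbertSchmidt

variable {ι κ τ E G : Type*}
  [NormedAddCommGroup E] [InnerProductSpace ℂ E]
  [NormedAddCommGroup G] [InnerProductSpace ℂ G]

/-! Write `F = U|F|`, and let `P = U*U` be the projection onto `(ker F)ᗮ` and `Q = X*X`. Sums of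
squared distances between frames are squared Hilbert–Schmidt norms of differences of synthesis
operators, so they may be computed in any orthonormal basis.

If some Parseval frame is quadratically close to `f`, then `|F| - P` is Hilbert–Schmidt
(`isHilbertSchmidt_modulus_sub`): with `A = F*F`, closeness to a projection makes `A² - A = |F|²(|F|
+ 1)(|F| - P)` Hilbert–Schmidt, and the lower frame bound allows division by `|F|²(|F| + 1)` on
`(ker F)ᗮ`. Hence `F - U = U(|F| - P)` is Hilbert–Schmidt, and `|F|` has an orthonormal eigenbasis
`g j` of `(ker F)ᗮ` with eigenvalues `s j > 0`.

Complete it by a basis `h k` of `ker F`. Then `‖F - U‖₂² = ∑ (s j - 1)²`, while `‖F - X‖₂² = ∑ ‖s j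
• U (g j) - X (g j)‖² + ∑ ‖X (h k)‖²`. Index zero gives `∑ ‖X (h k)‖² = ∑ (1 - ‖X (g j)‖²)`
(`tsum_ofReal_norm_sq_orthogonal`), so the excess is `∑ 2 s j (1 - Re⟪U (g j), X (g j)⟫) ≥ 0`. When
`‖F - U‖₂` is finite, equality forces `X (g j) = U (g j)` for all `j`, then `X (h k) = 0`, so `X =
U` (`polarFactor_closest`). -/

theorem hasSum_norm_inner_sq (b : HilbertBasis ι ℂ E) (x : E) :
    HasSum (fun i => ‖⟪b i, x⟫_ℂ‖ ^ 2) (‖x‖ ^ 2) := by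
  have h := b.hasSum_inner_mul_inner x x
  have h2 : ∀ i, ⟪x, b i⟫_ℂ * ⟪b i, x⟫_ℂ = ((‖⟪b i, x⟫_ℂ‖ ^ 2 : ℝ) : ℂ) := fun i => by
    rw [← inner_conj_symm x (b i)]
    push_cast
    exact RCLike.conj_mul _
  simp only [h2, inner_self_eq_norm_sq_to_K] at h
  have h3 : HasSum (fun i => ((‖⟪b i, x⟫_ℂ‖ ^ 2 : ℝ) : ℂ)) ((‖x‖ ^ 2 : ℝ) : ℂ) := by
    simpa using h
  exact Complex.hasSum_ofReal.1 h3

theorem tsum_ofReal_norm_inner_sq (b : HilbertBasis ι ℂ E) (x : E) :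
    ∑' i, ENNReal.ofReal (‖⟪b i, x⟫_ℂ‖ ^ 2) = ENNReal.ofReal (‖x‖ ^ 2) := by
  have h := hasSum_norm_inner_sq b x
  rw [← h.tsum_eq, ENNReal.ofReal_tsum_of_nonneg (fun _ => by positivity) h.summable]

theorem isCompactOperator_innerSL_smulRight (x : E) (y : G) :
    IsCompactOperator ((innerSL ℂ x).smulRight y) := by
  have h : IsCompactOperator (ContinuousLinearMap.toSpanSingleton ℂ y) :=
    isCompactOperator_of_locallyCompactSpace_rng _
  exact h.comp_clm (innerSL ℂ x)

variable [CompleteSpace E] [CompleteSpace G]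

/-- Both sides are the double sum of `|⟪T (b i), c j⟫|²`. With values in `[0, ∞]` the interchange
needs no summability. -/
theorem tsum_ofReal_norm_sq_adjoint (b : HilbertBasis ι ℂ E) (c : HilbertBasis κ ℂ G)
    (T : E →L[ℂ] G) :
    ∑' i, ENNReal.ofReal (‖T (b i)‖ ^ 2) = ∑' j, ENNReal.ofReal (‖adjoint T (c j)‖ ^ 2) := by
  simp_rw [← tsum_ofReal_norm_inner_sq c (T _), ← tsum_ofReal_norm_inner_sq b (adjoint T _)]
  rw [ENNReal.tsum_comm]
  simp_rw [ContinuousLinearMap.adjoint_inner_right, norm_inner_symm]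

/-- The Hilbert–Schmidt norm splits along an orthogonal decomposition of the domain. -/
theorem tsum_ofReal_norm_sq_split (M : Submodule ℂ E) [CompleteSpace M]
    (b : HilbertBasis ι ℂ E) (g : HilbertBasis κ ℂ M) (h : HilbertBasis τ ℂ Mᗮ)
    (T : E →L[ℂ] G) :
    ∑' i, ENNReal.ofReal (‖T (b i)‖ ^ 2) =
      ∑' j, ENNReal.ofReal (‖T (g j)‖ ^ 2) + ∑' k, ENNReal.ofReal (‖T (h k)‖ ^ 2) := by
  obtain ⟨w, c, -⟩ := exists_hilbertBasis ℂ G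
  have hadj : ∀ (N : Submodule ℂ E) [CompleteSpace N] (y : G),
      adjoint (T ∘L N.subtypeL) y = N.orthogonalProjectionOnto (adjoint T y) := fun N _ y => by
    rw [ContinuousLinearMap.adjoint_comp, Submodule.adjoint_subtypeL]
    rfl
  have h1 := tsum_ofReal_norm_sq_adjoint g c (T ∘L M.subtypeL)
  have h2 := tsum_ofReal_norm_sq_adjoint h c (T ∘L Mᗮ.subtypeL)
  -- On the adjoint side the splitting is Pythagoras for each vector `adjoint T (c j)`.
  rw [tsum_ofReal_norm_sq_adjoint b c T]
  refine Eq.trans ?_ (congrArg₂ (· + ·) h1 h2).symm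
  rw [← ENNReal.tsum_add]
  refine tsum_congr fun j => ?_
  rw [hadj, hadj, ← ENNReal.ofReal_add (by positivity) (by positivity),
    ← Submodule.norm_sq_eq_add_norm_sq_projection]

/-- Expand `adjoint T y` in the basis `b` and apply Cauchy–Schwarz to each coordinate `⟪T (b i),
y⟫`. -/
theorem norm_sq_le_tsum_norm_sq (b : HilbertBasis ι ℂ E) (T : E →L[ℂ] G)
    (hT : Summable fun i => ‖T (b i)‖ ^ 2) : ‖T‖ ^ 2 ≤ ∑' i, ‖T (b i)‖ ^ 2 := by
  have hnn : 0 ≤ ∑' i, ‖T (b i)‖ ^ 2 := tsum_nonneg fun _ => by positivity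
  rw [← Real.le_sqrt (norm_nonneg _) hnn, ← ContinuousLinearMap.adjoint.norm_map T]
  refine ContinuousLinearMap.opNorm_le_bound _ (Real.sqrt_nonneg _) fun y => ?_
  refine le_of_sq_le_sq ?_ (by positivity)
  rw [mul_pow, Real.sq_sqrt hnn, ← tsum_mul_right, ← (hasSum_norm_inner_sq b _).tsum_eq]
  refine (hasSum_norm_inner_sq b _).summable.tsum_le_tsum (fun i => ?_) (hT.mul_right _)
  rw [ContinuousLinearMap.adjoint_inner_right, ← mul_pow]
  gcongr
  exact norm_inner_le_norm _ _

/-- Hilbert–Schmidt operators are compact. -/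
theorem isCompactOperator_of_summable_norm_sq (b : HilbertBasis ι ℂ E) (T : E →L[ℂ] G)
    (hT : Summable fun i => ‖T (b i)‖ ^ 2) : IsCompactOperator T := by
  classical
  -- Finite-rank truncations of `T`; the operator norm of the error is at most the Hilbert–Schmidt
  -- tail.
  let S : Finset ι → E →L[ℂ] G := fun s => ∑ i ∈ s, (innerSL ℂ (b i)).smulRight (T (b i))
  have hS : ∀ s i, (T - S s) (b i) = if i ∈ s then 0 else T (b i) := fun s i => by
    have : S s (b i) = ∑ j ∈ s, if j = i then T (b i) else 0 := by
      simp only [S, sum_apply, ContinuousLinearMap.smulRight_apply,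
        innerSL_apply_apply, orthonormal_iff_ite.1 b.orthonormal]
      refine Finset.sum_congr rfl fun j _ => ?_
      split_ifs with h <;> simp [h]
    rw [sub_apply, this, Finset.sum_ite_eq' s i]
    split_ifs <;> simp
  have hSc : ∀ s, IsCompactOperator (S s) := fun s => by
    have : S s ∈ compactOperator (RingHom.id ℂ) E G :=
      Submodule.sum_mem _ fun i _ => isCompactOperator_innerSL_smulRight _ _
    exact this
  have hn : ∀ s, ‖T - S s‖ ^ 2 ≤ ∑' i : {i // i ∉ s}, ‖T (b i)‖ ^ 2 := fun s => by
    have he : (fun i => ‖(T - S s) (b i)‖ ^ 2) =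
        Set.indicator {i | i ∉ s} fun i => ‖T (b i)‖ ^ 2 := by
      ext i
      rw [hS]
      by_cases h : i ∈ s <;> simp [h]
    refine (norm_sq_le_tsum_norm_sq b _ ?_).trans_eq ?_
    · rw [he]
      exact hT.indicator _
    · rw [he]
      exact (tsum_subtype {i | i ∉ s} _).symm
  have h0 : Filter.Tendsto (fun s => ‖T - S s‖ ^ 2) Filter.atTop (nhds 0) :=
    squeeze_zero (fun _ => by positivity) hn
      (tendsto_tsum_compl_atTop_zero fun i => ‖T (b i)‖ ^ 2)
  have h1 : Filter.Tendsto S Filter.atTop (nhds T) := by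
    rw [tendsto_iff_norm_sub_tendsto_zero]
    have := h0.sqrt
    simp only [Real.sqrt_zero, Real.sqrt_sq (norm_nonneg _)] at this
    simpa only [norm_sub_rev] using this
  exact isCompactOperator_of_tendsto h1 (Filter.Eventually.of_forall hSc)

/-- A compact self-adjoint operator has a Hilbert basis of eigenvectors. -/
theorem exists_hilbertBasis_eigenvectors.{u} {E : Type u} [NormedAddCommGroup E]
    [InnerProductSpace ℂ E] [CompleteSpace E] (T : E →L[ℂ] E) (hT : IsCompactOperator T)
    (hT' : T.IsSymmetric) :
    ∃ (ι : Type u) (b : HilbertBasis ι ℂ E) (μ : ι → ℂ), ∀ i, T (b i) = μ i • b i := by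
  let V : ℂ → Submodule ℂ E := fun μ => Module.End.eigenspace (T : Module.End ℂ E) μ
  have hVc : ∀ μ, CompleteSpace (V μ) := fun μ => by
    have : IsClosed (V μ : Set E) := by
      have h : (V μ : Set E) = {x | T x = μ • x} := by
        ext x
        exact Module.End.mem_eigenspace_iff
      rw [h]
      exact isClosed_eq (by fun_prop) (by fun_prop)
    exact this.completeSpace_coe
  choose w c hc using fun μ => exists_hilbertBasis ℂ (V μ)
  have hVo : OrthogonalFamily ℂ (fun μ => V μ) fun μ => (V μ).subtypeₗᵢ :=
    LinearMap.IsSymmetric.orthogonalFamily_eigenspaces hT'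
  have hon := hVo.orthonormal_sigma_orthonormal (fun μ => (c μ).orthonormal)
  -- A vector orthogonal to the chosen bases is orthogonal to every eigenspace, hence zero by the
  -- spectral theorem.
  have hsp : (Submodule.span ℂ (Set.range fun a : Σ μ, w μ =>
      (V a.1).subtypeₗᵢ (c a.1 a.2)))ᗮ = ⊥ := by
    rw [eq_bot_iff,
      ← ContinuousLinearMap.orthogonalComplement_iSup_eigenspaces_eq_bot hT hT']
    intro x hx
    rw [← Submodule.iInf_orthogonal, Submodule.mem_iInf]
    intro μ
    have h0 : (V μ).orthogonalProjectionOnto x = 0 := by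
      have h := (c μ).hasSum_orthogonalProjectionOnto x
      have hz : ∀ i, ⟪((c μ i : V μ) : E), x⟫_ℂ = 0 := fun i =>
        (Submodule.mem_orthogonal _ _).1 hx _ (Submodule.subset_span ⟨⟨μ, i⟩, rfl⟩)
      simp only [hz, zero_smul] at h
      exact h.unique hasSum_zero
    exact (V μ).orthogonalProjectionOnto_eq_zero_iff.1 h0
  refine ⟨Σ μ, w μ, HilbertBasis.mkOfOrthogonalEqBot hon hsp, fun a => a.1, fun a => ?_⟩
  rw [HilbertBasis.coe_mkOfOrthogonalEqBot]
  exact Module.End.mem_eigenspace_iff.1 (c a.1 a.2).2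

end HilbertSchmidt

/-! ### Algebra of the polar decomposition. -/

section PartialIsometry

variable {E H : Type*}
  [NormedAddCommGroup E] [InnerProductSpace ℂ E] [CompleteSpace E]
  [NormedAddCommGroup H] [InnerProductSpace ℂ H] [CompleteSpace H]

/-- If `U` is a partial isometry, then `U* U` is the projection onto `(ker U)ᗮ`. -/
theorem adjoint_comp_self_of_isometric {U : E →L[ℂ] H} (hU : ∀ x ∈ (U.ker)ᗮ, ‖U x‖ = ‖x‖) :
    adjoint U ∘L U = (U.ker)ᗮ.starProjection := by
  -- Over `ℂ` the quadratic form determines the operator; both forms equal the squared norm of the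
  -- projection of `x`.
  refine ContinuousLinearMap.coe_injective ((ext_inner_map _ _).1 fun x => ?_)
  have h1 : U x = U ((U.ker)ᗮ.starProjection x) := by
    have h : x - (U.ker)ᗮ.starProjection x ∈ U.ker := by
      have := Submodule.sub_starProjection_mem_orthogonal (K := (U.ker)ᗮ) x
      rwa [Submodule.orthogonal_orthogonal] at this
    rw [← sub_eq_zero, ← map_sub]
    exact h
  have h2 : ‖U x‖ = ‖(U.ker)ᗮ.starProjection x‖ := by
    rw [h1, hU _ (Submodule.starProjection_apply_mem _ x)]
  change ⟪adjoint U (U x), x⟫_ℂ = ⟪(U.ker)ᗮ.starProjection x, x⟫_ℂ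
  rw [ContinuousLinearMap.adjoint_inner_left, inner_self_eq_norm_sq_to_K, h2,
    ← inner_self_eq_norm_sq_to_K, Submodule.inner_starProjection_left_eq_right,
    Submodule.starProjection_eq_self_iff.2 (Submodule.starProjection_apply_mem _ x),
    ← Submodule.inner_starProjection_left_eq_right]

theorem adjoint_polarFactor_comp_polarFactor (F : E →L[ℂ] H) :
    adjoint (polarFactor F) ∘L polarFactor F = (F.ker)ᗮ.starProjection := by
  rw [adjoint_comp_self_of_isometric (polarFactor_spec F).isometric]
  congr! 2
  rw [(polarFactor_spec F).ker_eq]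

theorem modulus_apply_starProjection (F : E →L[ℂ] H) (x : E) :
    modulus F ((F.ker)ᗮ.starProjection x) = modulus F x := by
  have h : x - (F.ker)ᗮ.starProjection x ∈ (modulus F).ker := by
    have := Submodule.sub_starProjection_mem_orthogonal (K := (F.ker)ᗮ) x
    rw [Submodule.orthogonal_orthogonal] at this
    exact (ker_modulus F).symm ▸ this
  rw [eq_comm, ← sub_eq_zero, ← map_sub]
  exact h

theorem modulus_apply_mem (F : E →L[ℂ] H) (x : E) : modulus F x ∈ (F.ker)ᗮ := by
  rw [← closure_range_modulus]
  exact Submodule.le_topologicalClosure _ (LinearMap.mem_range_self _ x)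

theorem polarFactor_modulus_apply (F : E →L[ℂ] H) (x : E) :
    polarFactor F (modulus F x) = F x :=
  (congrArg (fun T : E →L[ℂ] H => T x) (polarFactor_spec F).factor).symm

/-- `F*U = |F|U*U`, and `U*U` is the projection off `ker |F|`. -/
theorem adjoint_apply_polarFactor (F : E →L[ℂ] H) (x : E) :
    adjoint F (polarFactor F x) = modulus F x := by
  conv_lhs => rw [(polarFactor_spec F).factor]
  rw [ContinuousLinearMap.adjoint_comp, ContinuousLinearMap.comp_apply,
    ← ContinuousLinearMap.star_eq_adjoint (modulus F), (modulus_isSelfAdjoint F).star_eq]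
  have h := congrArg (fun T : E →L[ℂ] E => T x) (adjoint_polarFactor_comp_polarFactor F)
  -- The rewriting of `F` also reached the argument of `polarFactor`; this undoes it there.
  have hfac : polarFactor (polarFactor F ∘L modulus F) = polarFactor F := by
    rw [← (polarFactor_spec F).factor]
  rw [hfac]
  simp only [ContinuousLinearMap.comp_apply] at h
  rw [h, modulus_apply_starProjection]

end PartialIsometry

/-! ### Unitary polar factors of index-zero operators. -/

section FredholmIndex

variable {M N : Type*}
  [NormedAddCommGroup M] [InnerProductSpace ℂ M] [CompleteSpace M]
  [NormedAddCommGroup N] [InnerProductSpace ℂ N] [CompleteSpace N]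

theorem norm_polarFactor_apply_sq (T : M →L[ℂ] N) (m : M) :
    ‖polarFactor T m‖ ^ 2 + ‖T.ker.orthogonalProjectionOnto m‖ ^ 2 = ‖m‖ ^ 2 := by
  have h := congrArg (fun S : M →L[ℂ] M => ⟪S m, m⟫_ℂ) (adjoint_polarFactor_comp_polarFactor T)
  simp only [ContinuousLinearMap.comp_apply] at h
  rw [ContinuousLinearMap.adjoint_inner_left, inner_self_eq_norm_sq_to_K,
    ← Submodule.starProjection_eq_self_iff.2 (Submodule.starProjection_apply_mem _ m),
    Submodule.inner_starProjection_left_eq_right, inner_self_eq_norm_sq_to_K] at h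
  have h2 : ‖polarFactor T m‖ ^ 2 = ‖(T.ker)ᗮ.starProjection m‖ ^ 2 := by exact_mod_cast h
  rw [h2, Submodule.norm_sq_eq_add_norm_sq_projection m T.ker, add_comm]
  rfl

/-- A Fredholm operator of index zero has a polar decomposition with a unitary factor. -/
theorem exists_linearIsometryEquiv_of_index_eq_zero (T : M →L[ℂ] N) (hT : T.IsFredholm)
    (h0 : T.toLinearMap.index = 0) :
    ∃ V : M ≃ₗᵢ[ℂ] N, ∀ m, ‖adjoint T (V m)‖ = ‖T m‖ := by
  have : FiniteDimensional ℂ T.ker := hT.finite_ker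
  have hcl : IsClosed (T.range : Set N) := hT.isClosed_range
  have : CompleteSpace T.range := hcl.completeSpace_coe
  have : FiniteDimensional ℂ (N ⧸ T.range) := hT.finite_coker
  have hq := (T.range).quotientEquivOrthogonal.toLinearEquiv
  have : FiniteDimensional ℂ (T.range)ᗮ := Module.Finite.equiv hq
  have hdim : Module.finrank ℂ T.ker = Module.finrank ℂ (T.range)ᗮ := by
    rw [LinearMap.index_eq_finrank_sub] at h0
    rw [← hq.finrank_eq]
    exact_mod_cast sub_eq_zero.1 h0
  -- Index zero makes the finite dimensions of `ker T` and `(ran T)ᗮ` equal; `φ` fills in the polar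
  -- factor on its kernel.
  let φ : T.ker ≃ₗᵢ[ℂ] (T.range)ᗮ := (stdOrthonormalBasis ℂ T.ker).equiv
    (stdOrthonormalBasis ℂ (T.range)ᗮ) (finCongr hdim)
  have hW : ∀ m, polarFactor T m ∈ T.range := by
    intro m
    have h1 : T.ker.starProjection m ∈ (polarFactor T).ker :=
      (polarFactor_spec T).ker_eq.symm ▸ Submodule.starProjection_apply_mem _ m
    have h2 : polarFactor T m = polarFactor T (m - T.ker.starProjection m) := by
      rw [map_sub, show polarFactor T (T.ker.starProjection m) = 0 from h1, sub_zero]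
    have h3 : m - T.ker.starProjection m ∈ (modulus T).range.topologicalClosure :=
      (closure_range_modulus T).symm ▸ Submodule.sub_starProjection_mem_orthogonal m
    have h4 : polarFactor T (m - T.ker.starProjection m) ∈ closure (T.range : Set N) := by
      refine map_mem_closure (polarFactor T).continuous h3 ?_
      rintro _ ⟨x, rfl⟩
      exact ⟨x, (polarFactor_modulus_apply T x).symm⟩
    rw [h2]
    rwa [hcl.closure_eq] at h4
  let V₀ : M →ₗ[ℂ] N := (polarFactor T).toLinearMap +
    (T.range)ᗮ.subtype ∘ₗ φ.toLinearEquiv.toLinearMap ∘ₗ T.ker.orthogonalProjectionOnto.toLinearMap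
  have hV₀ : ∀ m, V₀ m = polarFactor T m + φ (T.ker.orthogonalProjectionOnto m) := fun _ => rfl
  have hn : ∀ m, ‖V₀ m‖ = ‖m‖ := by
    intro m
    have h := norm_add_sq_eq_norm_sq_add_norm_sq_of_inner_eq_zero (𝕜 := ℂ) (polarFactor T m)
      (φ (T.ker.orthogonalProjectionOnto m) : N)
      ((Submodule.mem_orthogonal _ _).1 (φ (T.ker.orthogonalProjectionOnto m)).2 _ (hW m))
    rw [← hV₀, ← sq, ← sq, ← sq, Submodule.norm_coe, φ.norm_map, norm_polarFactor_apply_sq] at h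
    exact (sq_eq_sq₀ (norm_nonneg _) (norm_nonneg _)).1 h
  have hs : Function.Surjective V₀ := by
    intro y
    obtain ⟨x, hx⟩ : T.range.starProjection y ∈ T.range := Submodule.starProjection_apply_mem _ y
    have hz : y - T.range.starProjection y ∈ (T.range)ᗮ :=
      Submodule.sub_starProjection_mem_orthogonal y
    obtain ⟨z, hz'⟩ := φ.surjective ⟨_, hz⟩
    refine ⟨modulus T x + z, ?_⟩
    have h1 : T.ker.orthogonalProjectionOnto (modulus T x) = 0 :=
      Submodule.orthogonalProjectionOnto_eq_zero_iff.2 (modulus_apply_mem T x)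
    have h2 : polarFactor T z = 0 := by
      have : (z : M) ∈ (polarFactor T).ker := by
        rw [(polarFactor_spec T).ker_eq]
        exact z.2
      exact this
    rw [hV₀, map_add, map_add, h1, h2, polarFactor_modulus_apply, zero_add, add_zero,
      Submodule.orthogonalProjectionOnto_mem_subspace_eq_self, hz']
    change T x + (y - T.range.starProjection y) = y
    have hx' : T x = T.range.starProjection y := hx
    rw [hx', add_sub_cancel]
  refine ⟨LinearIsometryEquiv.ofSurjective ⟨V₀, hn⟩ hs, fun m => ?_⟩
  change ‖adjoint T (V₀ m)‖ = _
  -- `(ran T)ᗮ = ker T*`, so the added piece is invisible to `adjoint T`.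
  have hk : adjoint T (φ (T.ker.orthogonalProjectionOnto m) : N) = 0 := by
    have h := (φ (T.ker.orthogonalProjectionOnto m)).2
    have h' := (ContinuousLinearMap.orthogonal_range T).le h
    exact h'
  rw [hV₀, map_add, hk, add_zero, adjoint_apply_polarFactor, norm_modulus_apply]

end FredholmIndex

/-! ### Pairs of projections of index zero. -/

section ProjectionPair

variable {ι κ E : Type*} [NormedAddCommGroup E] [InnerProductSpace ℂ E] [CompleteSpace E]

theorem adjoint_pairOperator_apply {P Q : E →L[ℂ] E} (hP : IsStarProjection P)
    (hQ : IsStarProjection Q) [CompleteSpace P.range] [CompleteSpace Q.range] (y : Q.range) :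
    (adjoint (pairOperator P Q) y : E) = P y := by
  have hsP : ∀ x y, ⟪P x, y⟫_ℂ = ⟪x, P y⟫_ℂ := hP.isSelfAdjoint.isSymmetric
  have hsQ : ∀ x y, ⟪Q x, y⟫_ℂ = ⟪x, Q y⟫_ℂ := hQ.isSelfAdjoint.isSymmetric
  have hPP : ∀ x : P.range, P x = x := by
    rintro ⟨_, x, rfl⟩
    exact congrArg (fun T : E →L[ℂ] E => T x) hP.isIdempotentElem
  have hQQ : ∀ x : Q.range, Q x = x := by
    rintro ⟨_, x, rfl⟩
    exact congrArg (fun T : E →L[ℂ] E => T x) hQ.isIdempotentElem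
  have h : adjoint (pairOperator P Q) y = ⟨P y, ⟨y, rfl⟩⟩ := by
    refine ext_inner_left ℂ fun v => ?_
    rw [ContinuousLinearMap.adjoint_inner_right]
    change ⟪Q (P v), (y : E)⟫_ℂ = ⟪(v : E), P y⟫_ℂ
    rw [hsQ, hQQ, hsP]
  rw [h]

/-- For a Fredholm pair of projections of index zero, any Hilbert basis of `ran P` can be matched
with a Hilbert basis of `ran Q` making the same angles with the other subspace. -/
theorem exists_hilbertBasis_range {P Q : E →L[ℂ] E} (hP : IsStarProjection P)
    (hQ : IsStarProjection Q) [CompleteSpace P.range] [CompleteSpace Q.range]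
    (hPQ : IsFredholmPairOfIndex P Q 0) (g : HilbertBasis ι ℂ P.range) :
    ∃ c : HilbertBasis ι ℂ Q.range, ∀ i, ‖P (c i)‖ = ‖Q (g i)‖ := by
  classical
  obtain ⟨V, hV⟩ := exists_linearIsometryEquiv_of_index_eq_zero _ hPQ.1 hPQ.2
  -- The new basis is `V (g i)`, with `V` the unitary attached to `pairOperator P Q`.
  refine ⟨HilbertBasis.ofRepr (V.symm.trans g.repr), fun i => ?_⟩
  have hPP : ∀ x : P.range, P x = x := by
    rintro ⟨_, x, rfl⟩
    exact congrArg (fun T : E →L[ℂ] E => T x) hP.isIdempotentElem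
  have h1 : (HilbertBasis.ofRepr (V.symm.trans g.repr) : HilbertBasis ι ℂ Q.range) i =
      V (g i) := by
    rw [← HilbertBasis.repr_symm_single, ← HilbertBasis.repr_symm_single]
    rfl
  have h2 := hV (g i)
  rw [Submodule.coe_norm, Submodule.coe_norm, adjoint_pairOperator_apply hP hQ] at h2
  rw [h1, h2]
  change ‖Q (P (g i))‖ = _
  rw [hPP]

/-- For a Fredholm pair of projections of index zero, `‖Q (1 - P)‖₂ = ‖(1 - Q) P‖₂`. -/
theorem tsum_ofReal_norm_sq_orthogonal {P Q : E →L[ℂ] E} (hP : IsStarProjection P)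
    (hQ : IsStarProjection Q) [CompleteSpace P.range] [CompleteSpace Q.range]
    (hPQ : IsFredholmPairOfIndex P Q 0) (g : HilbertBasis ι ℂ P.range)
    (h : HilbertBasis κ ℂ (P.range)ᗮ) :
    ∑' k, ENNReal.ofReal (‖Q (h k)‖ ^ 2) = ∑' i, ENNReal.ofReal (1 - ‖Q (g i)‖ ^ 2) := by
  obtain ⟨c, hc⟩ := exists_hilbertBasis_range hP hQ hPQ g
  have hsQ : ∀ x y, ⟪Q x, y⟫_ℂ = ⟪x, Q y⟫_ℂ := hQ.isSelfAdjoint.isSymmetric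
  have hQQ : ∀ x : Q.range, Q x = x := by
    rintro ⟨_, x, rfl⟩
    exact congrArg (fun T : E →L[ℂ] E => T x) hQ.isIdempotentElem
  obtain ⟨_, hPr⟩ := isStarProjection_iff_eq_starProjection_range.1 hP
  -- `R` is `Q` on `(ran P)ᗮ`, and its adjoint is `1 - P` on `ran Q`; the sum is evaluated through
  -- the adjoint on the matched basis `c`.
  let R : (P.range)ᗮ →L[ℂ] Q.range :=
    (Q ∘L (P.range)ᗮ.subtypeL).codRestrict Q.range fun x => ⟨x, rfl⟩
  have hR : ∀ y : Q.range, adjoint R y = (P.range)ᗮ.orthogonalProjectionOnto (y : E) := by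
    intro y
    refine ext_inner_left ℂ fun v => ?_
    rw [ContinuousLinearMap.adjoint_inner_right]
    change ⟪Q v, (y : E)⟫_ℂ = _
    rw [hsQ, hQQ, Submodule.inner_orthogonalProjectionOnto_eq_of_mem_left]
  refine (tsum_ofReal_norm_sq_adjoint h c R).trans (tsum_congr fun i => ?_)
  rw [hR, ← hc]
  have h1 := Submodule.norm_sq_eq_add_norm_sq_projection (c i : E) P.range
  have h2 : ‖(c i : E)‖ = 1 := by
    rw [Submodule.norm_coe]
    exact c.orthonormal.1 i
  have h3 : ‖P.range.orthogonalProjectionOnto (c i : E)‖ = ‖P (c i)‖ := by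
    conv_rhs => rw [hPr]
    rfl
  rw [h2, h3] at h1
  congr 1
  linarith

end ProjectionPair

open scoped ComplexOrder

/-! ### Minimality of the polar factor. -/

section Preliminaries

variable {H : Type*} [NormedAddCommGroup H] [InnerProductSpace ℂ H]

/-- Applied with `u = U (g j)`, `v = X (g j)`; the term `1 - ‖v‖²` is the contribution transferred
from `ker F` by index zero. -/
theorem norm_smul_sub_sq {u v : H} (hu : ‖u‖ = 1) (s : ℝ) :
    ‖(s : ℂ) • u - v‖ ^ 2 + (1 - ‖v‖ ^ 2) = (s - 1) ^ 2 + 2 * s * (1 - (⟪u, v⟫_ℂ).re) := by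
  have h := norm_sub_sq (𝕜 := ℂ) ((s : ℂ) • u) v
  rw [inner_smul_left, norm_smul, hu, Complex.conj_ofReal, RCLike.re_to_complex,
    Complex.re_ofReal_mul, Complex.norm_real, Real.norm_eq_abs, mul_one, sq_abs] at h
  rw [h]
  ring

theorem re_inner_le_one {u v : H} (hu : ‖u‖ = 1) (hv : ‖v‖ ≤ 1) : (⟪u, v⟫_ℂ).re ≤ 1 := by
  have h := re_inner_le_norm (𝕜 := ℂ) u v
  rw [hu, one_mul] at h
  exact h.trans hv

theorem eq_of_re_inner_eq_one {u v : H} (hu : ‖u‖ = 1) (hv : ‖v‖ ≤ 1)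
    (h : (⟪u, v⟫_ℂ).re = 1) : v = u := by
  have h1 := norm_sub_sq (𝕜 := ℂ) u v
  rw [RCLike.re_to_complex, h, hu] at h1
  have h2 : ‖u - v‖ ^ 2 ≤ 0 := by nlinarith [norm_nonneg v]
  exact (sub_eq_zero.1 (norm_eq_zero.1 (pow_eq_zero_iff two_ne_zero |>.1
    (le_antisymm h2 (by positivity))))).symm

theorem isClosed_range_of_isIdempotentElem {P : H →L[ℂ] H} (hP : IsIdempotentElem P) :
    IsClosed (P.range : Set H) := by
  have h : (P.range : Set H) = {x | P x = x} := by
    ext x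
    refine ⟨?_, fun hx => ⟨x, hx⟩⟩
    rintro ⟨y, rfl⟩
    exact congrArg (fun T : H →L[ℂ] H => T y) hP
  rw [h]
  exact isClosed_eq (by fun_prop) (by fun_prop)

end Preliminaries

section Minimality

universe u
variable {κ H : Type*} {E : Type u} [NormedAddCommGroup E] [InnerProductSpace ℂ E] [CompleteSpace E]
  [NormedAddCommGroup H] [InnerProductSpace ℂ H] [CompleteSpace H]

/-- If `|F| - U* U` is compact, then `|F|` is diagonalizable on `(ker F)ᗮ`. -/
theorem exists_hilbertBasis_modulus (F : E →L[ℂ] H)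
    (hF : IsCompactOperator (modulus F - (F.ker)ᗮ.starProjection)) :
    ∃ (ι : Type u) (g : HilbertBasis ι ℂ (F.ker)ᗮ) (s : ι → ℝ),
      ∀ i, 0 < s i ∧ modulus F (g i) = (s i : ℂ) • (g i : E) := by
  set D : E →L[ℂ] E := modulus F - (F.ker)ᗮ.starProjection with hDdef
  have hDsymm : D.IsSymmetric :=
    ((modulus_isSelfAdjoint F).sub isStarProjection_starProjection.isSelfAdjoint).isSymmetric
  have hinv : ∀ x ∈ (F.ker)ᗮ, D x ∈ (F.ker)ᗮ := fun x _ =>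
    sub_mem (modulus_apply_mem F x) (Submodule.starProjection_apply_mem _ x)
  obtain ⟨ι, g, μ, hg⟩ := exists_hilbertBasis_eigenvectors (D.restrict hinv)
    (hF.restrict' (f := D.toLinearMap) hinv) (hDsymm.restrict_invariant hinv)
  have heig : ∀ i, modulus F (g i) = (μ i + 1) • (g i : E) := fun i => by
    have h1 : D (g i) = μ i • (g i : E) := congrArg Subtype.val (hg i)
    have h2 : (F.ker)ᗮ.starProjection (g i : E) = g i :=
      Submodule.starProjection_eq_self_iff.2 (g i).2
    rw [hDdef, sub_apply, h2, sub_eq_iff_eq_add] at h1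
    rw [h1, add_smul, one_smul]
  have hn : ∀ i, ‖(g i : E)‖ = 1 := fun i => g.orthonormal.1 i
  have hnn : ∀ i, 0 ≤ μ i + 1 := fun i => by
    have h := ((ContinuousLinearMap.nonneg_iff_isPositive _).1
      (modulus_nonneg F)).inner_nonneg_right (g i : E)
    rwa [heig, inner_smul_right, inner_self_eq_norm_sq_to_K, hn, RCLike.ofReal_one, one_pow,
      mul_one] at h
  have hre : ∀ i, (((μ i + 1).re : ℝ) : ℂ) = μ i + 1 := fun i =>
    Complex.ext rfl (Complex.nonneg_iff.1 (hnn i)).2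
  refine ⟨ι, g, fun i => (μ i + 1).re, fun i => ⟨?_, by rw [hre, heig]⟩⟩
  -- A zero eigenvalue would put the unit vector `g i` in both `ker F` and its complement.
  refine lt_of_le_of_ne (Complex.nonneg_iff.1 (hnn i)).1 fun h0 => ?_
  have h0' : modulus F (g i) = 0 := by
    rw [heig, ← hre, ← show 0 = (μ i + 1).re from h0, Complex.ofReal_zero, zero_smul]
  have h1 : (g i : E) ∈ F.ker := (ker_modulus F).le h0'
  have h2 : ⟪(g i : E), g i⟫_ℂ = 0 := (Submodule.mem_orthogonal _ _).1 (g i).2 _ h1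
  rw [inner_self_eq_zero] at h2
  simpa [h2] using hn i

theorem norm_adjoint_comp_self_apply {X : E →L[ℂ] H} (hX : IsStarProjection (adjoint X ∘L X))
    (x : E) : ‖(adjoint X ∘L X) x‖ = ‖X x‖ := by
  have h : ⟪(adjoint X ∘L X) x, (adjoint X ∘L X) x⟫_ℂ = ⟪X x, X x⟫_ℂ := by
    have h1 : (adjoint X ∘L X) ((adjoint X ∘L X) x) = (adjoint X ∘L X) x :=
      congrArg (fun T : E →L[ℂ] E => T x) hX.isIdempotentElem
    have h2 : ∀ x y, ⟪(adjoint X ∘L X) x, y⟫_ℂ = ⟪x, (adjoint X ∘L X) y⟫_ℂ :=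
      hX.isSelfAdjoint.isSymmetric
    rw [h2, h1, ContinuousLinearMap.comp_apply, ContinuousLinearMap.adjoint_inner_right]
  rw [inner_self_eq_norm_sq_to_K, inner_self_eq_norm_sq_to_K] at h
  have h2 : ‖(adjoint X ∘L X) x‖ ^ 2 = ‖X x‖ ^ 2 := by exact_mod_cast h
  exact (sq_eq_sq₀ (norm_nonneg _) (norm_nonneg _)).1 h2

/-- Among the partial isometries `X` with `j(U* U, X* X) = 0`, the polar factor `U` of `F` is the
unique closest one to `F` in the Hilbert–Schmidt norm. -/
theorem polarFactor_closest {F X : E →L[ℂ] H}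
    (hF : IsCompactOperator (modulus F - (F.ker)ᗮ.starProjection))
    (hX : IsStarProjection (adjoint X ∘L X))
    (hind : IsFredholmPairOfIndex (adjoint (polarFactor F) ∘L polarFactor F) (adjoint X ∘L X) 0)
    (b : HilbertBasis κ ℂ E) :
    ∑' i, ENNReal.ofReal (‖(F - polarFactor F) (b i)‖ ^ 2) ≤
        ∑' i, ENNReal.ofReal (‖(F - X) (b i)‖ ^ 2) ∧
      (∑' i, ENNReal.ofReal (‖(F - polarFactor F) (b i)‖ ^ 2) ≠ ⊤ →
        ∑' i, ENNReal.ofReal (‖(F - polarFactor F) (b i)‖ ^ 2) =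
          ∑' i, ENNReal.ofReal (‖(F - X) (b i)‖ ^ 2) → X = polarFactor F) := by
  set U := polarFactor F with hU
  rw [adjoint_polarFactor_comp_polarFactor] at hind
  set P : E →L[ℂ] E := (F.ker)ᗮ.starProjection with hPdef
  set Q : E →L[ℂ] E := adjoint X ∘L X with hQdef
  have hP : IsStarProjection P := isStarProjection_starProjection
  have hPr : P.range = (F.ker)ᗮ := Submodule.range_starProjection _
  obtain ⟨ι, g', s, hs'⟩ := exists_hilbertBasis_modulus F hF
  obtain ⟨g, hs⟩ : ∃ g : HilbertBasis ι ℂ P.range,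
      ∀ i, 0 < s i ∧ modulus F (g i) = (s i : ℂ) • (g i : E) := by
    rw [hPr]
    exact ⟨g', hs'⟩
  have : CompleteSpace P.range := by
    rw [hPr]
    infer_instance
  have : CompleteSpace Q.range := by
    exact (isClosed_range_of_isIdempotentElem hX.isIdempotentElem).completeSpace_coe
  obtain ⟨τ, h, -⟩ := exists_hilbertBasis ℂ (P.range)ᗮ
  have hker : ∀ k, (h k : E) ∈ F.ker := fun k => by
    have h1 : (h k : E) ∈ ((F.ker)ᗮ)ᗮ := hPr ▸ (h k).2
    rwa [Submodule.orthogonal_orthogonal] at h1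
  have hFh : ∀ k, F (h k) = 0 := hker
  have hUh : ∀ k, U (h k) = 0 := fun k => by
    have : (h k : E) ∈ U.ker := by
      rw [hU, (polarFactor_spec F).ker_eq]
      exact hker k
    exact this
  have hUg : ∀ j, ‖U (g j)‖ = 1 := fun j => by
    rw [(polarFactor_spec F).isometric]
    · exact g.orthonormal.1 j
    · rw [(polarFactor_spec F).ker_eq, ← hPr]
      exact (g j).2
  have hFg : ∀ j, F (g j) = (s j : ℂ) • U (g j) := fun j => by
    rw [← polarFactor_modulus_apply, (hs j).2, map_smul]
  have hQX : ∀ x, ‖Q x‖ = ‖X x‖ := norm_adjoint_comp_self_apply hX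
  have hXg : ∀ j, ‖X (g j)‖ ≤ 1 := fun j => by
    obtain ⟨_, hQ⟩ := isStarProjection_iff_eq_starProjection_range.1 hX
    rw [← hQX, hQ]
    exact (Submodule.norm_starProjection_apply_le _ _).trans_eq (g.orthonormal.1 j)
  -- The only use of the index hypothesis.
  have hXh : ∑' k, ENNReal.ofReal (‖X (h k)‖ ^ 2) =
      ∑' j, ENNReal.ofReal (1 - ‖X (g j)‖ ^ 2) := by
    simpa only [hQX] using tsum_ofReal_norm_sq_orthogonal hP hX hind g h
  have hsumU : ∑' i, ENNReal.ofReal (‖(F - U) (b i)‖ ^ 2) =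
      ∑' j, ENNReal.ofReal ((s j - 1) ^ 2) := by
    rw [tsum_ofReal_norm_sq_split P.range b g h]
    have h1 : ∀ k, (F - U) (h k) = 0 := fun k => by rw [sub_apply, hFh, hUh, sub_zero]
    have h2 : ∀ j, ‖(F - U) (g j)‖ ^ 2 = (s j - 1) ^ 2 := fun j => by
      have : (F - U) (g j) = ((s j - 1 : ℝ) : ℂ) • U (g j) := by
        rw [sub_apply, hFg]
        push_cast
        rw [sub_smul, one_smul]
      rw [this, norm_smul, hUg, Complex.norm_real, Real.norm_eq_abs, mul_one, sq_abs]
    simp only [h1, h2, norm_zero, ne_eq, OfNat.ofNat_ne_zero, not_false_eq_true, zero_pow,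
      ENNReal.ofReal_zero, tsum_zero, add_zero]
  have hsumX : ∑' i, ENNReal.ofReal (‖(F - X) (b i)‖ ^ 2) =
      ∑' j, ENNReal.ofReal ((s j - 1) ^ 2 + 2 * s j * (1 - (⟪U (g j), X (g j)⟫_ℂ).re)) := by
    rw [tsum_ofReal_norm_sq_split P.range b g h]
    have h1 : ∀ k, ‖(F - X) (h k)‖ = ‖X (h k)‖ := fun k => by
      rw [sub_apply, hFh, zero_sub, norm_neg]
    simp only [h1]
    rw [hXh, ← ENNReal.tsum_add]
    refine tsum_congr fun j => ?_
    rw [← norm_smul_sub_sq (hUg j), sub_apply, hFg, ENNReal.ofReal_add (by positivity)]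
    have := hXg j
    nlinarith [norm_nonneg (X (g j))]
  have hle : ∀ j, (s j - 1) ^ 2 ≤
      (s j - 1) ^ 2 + 2 * s j * (1 - (⟪U (g j), X (g j)⟫_ℂ).re) := fun j => by
    have h1 := re_inner_le_one (hUg j) (hXg j)
    have h2 := mul_nonneg (hs j).1.le (sub_nonneg.2 h1)
    linarith
  rw [hsumU, hsumX]
  refine ⟨ENNReal.tsum_le_tsum fun j => ENNReal.ofReal_le_ofReal (hle j), fun hfin heq => ?_⟩
  have hXU : ∀ j, X (g j) = U (g j) := fun j => by
    refine eq_of_re_inner_eq_one (hUg j) (hXg j) ?_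
    refine le_antisymm (re_inner_le_one (hUg j) (hXg j)) (not_lt.1 fun hlt => ?_)
    have h2 := mul_pos (hs j).1 (sub_pos.2 hlt)
    -- One strict term makes the sums differ, because the smaller sum is finite.
    refine (ENNReal.tsum_lt_tsum (i := j) hfin
      (fun j => ENNReal.ofReal_le_ofReal (hle j)) ?_).ne heq
    exact (ENNReal.ofReal_lt_ofReal_iff_of_nonneg (by positivity)).2 (by linarith)
  have hXh0 : ∀ k, X (h k) = 0 := by
    simpa [hXU, hUg] using hXh
  have hzero : ∑' i, ENNReal.ofReal (‖(X - U) (b i)‖ ^ 2) = 0 := by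
    rw [tsum_ofReal_norm_sq_split P.range b g h]
    simp [hXU, hXh0, hUh]
  have hzb : ∀ i, ‖(X - U) (b i)‖ ^ 2 = 0 := fun i =>
    le_antisymm (ENNReal.ofReal_eq_zero.1 (ENNReal.tsum_eq_zero.1 hzero i)) (by positivity)
  have hn := norm_sq_le_tsum_norm_sq b (X - U) (by simpa only [hzb] using summable_zero)
  simp only [hzb, tsum_zero] at hn
  exact sub_eq_zero.1 (norm_eq_zero.1 (pow_eq_zero_iff two_ne_zero |>.1
    (le_antisymm hn (by positivity))))

end Minimality

/-! ### Ideal properties of Hilbert–Schmidt operators. -/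

section HilbertSchmidtIdeal

variable {ι E G G' : Type*}
  [NormedAddCommGroup E] [InnerProductSpace ℂ E]
  [NormedAddCommGroup G] [InnerProductSpace ℂ G]
  [NormedAddCommGroup G'] [InnerProductSpace ℂ G']

theorem norm_le_norm_add_of_nonneg {A : E →L[ℂ] E} (hA : 0 ≤ A) (x : E) : ‖x‖ ≤ ‖A x + x‖ := by
  have h := ((ContinuousLinearMap.nonneg_iff_isPositive _).1 hA).re_inner_nonneg_right x
  have h2 := norm_add_sq (𝕜 := ℂ) (A x) x
  rw [← inner_re_symm] at h2
  refine le_of_sq_le_sq ?_ (norm_nonneg _)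
  nlinarith [sq_nonneg ‖A x‖]

/-- `T` is a Hilbert–Schmidt operator, tested on the Hilbert basis `b`. -/
def IsHilbertSchmidt (b : HilbertBasis ι ℂ E) (T : E →L[ℂ] G) : Prop :=
  Summable fun i => ‖T (b i)‖ ^ 2

theorem IsHilbertSchmidt.add {b : HilbertBasis ι ℂ E} {S T : E →L[ℂ] G}
    (hS : IsHilbertSchmidt b S) (hT : IsHilbertSchmidt b T) : IsHilbertSchmidt b (S + T) := by
  refine Summable.of_nonneg_of_le (fun _ => by positivity) (fun i => ?_)
    ((Summable.add hS hT).mul_left 2)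
  have h1 := norm_add_le (S (b i)) (T (b i))
  have h2 := pow_le_pow_left₀ (norm_nonneg _) h1 2
  rw [add_apply]
  nlinarith [sq_nonneg (‖S (b i)‖ - ‖T (b i)‖)]

theorem IsHilbertSchmidt.neg {b : HilbertBasis ι ℂ E} {T : E →L[ℂ] G}
    (hT : IsHilbertSchmidt b T) : IsHilbertSchmidt b (-T) := by
  simpa only [IsHilbertSchmidt, neg_apply, norm_neg] using hT

theorem IsHilbertSchmidt.comp_left {b : HilbertBasis ι ℂ E} {T : E →L[ℂ] G}
    (hT : IsHilbertSchmidt b T) (A : G →L[ℂ] G') : IsHilbertSchmidt b (A ∘L T) := by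
  refine Summable.of_nonneg_of_le (fun _ => by positivity) (fun i => ?_) (hT.mul_left (‖A‖ ^ 2))
  rw [← mul_pow]
  exact pow_le_pow_left₀ (norm_nonneg _) (A.le_opNorm _) 2

theorem IsHilbertSchmidt.adjoint [CompleteSpace E] {b : HilbertBasis ι ℂ E} {T : E →L[ℂ] E}
    (hT : IsHilbertSchmidt b T) : IsHilbertSchmidt b (adjoint T) := by
  have h := tsum_ofReal_norm_sq_adjoint b b T
  have hT' : Summable fun i => ‖T (b i)‖ ^ 2 := hT
  rw [← ENNReal.ofReal_tsum_of_nonneg (fun _ => by positivity) hT'] at h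
  have h2 := ENNReal.summable_toReal (h ▸ ENNReal.ofReal_ne_top)
  exact h2.congr fun i => ENNReal.toReal_ofReal (by positivity)

/-- If `A - Q` is Hilbert–Schmidt for a projection `Q`, then so is `A² - A`. -/
theorem IsHilbertSchmidt.sq_sub_self [CompleteSpace E] {b : HilbertBasis ι ℂ E} {A Q : E →L[ℂ] E}
    (hA : IsSelfAdjoint A) (hQ : IsStarProjection Q) (h : IsHilbertSchmidt b (A - Q)) :
    IsHilbertSchmidt b (A ∘L A - A) := by
  -- Right multiplication is reduced to left multiplication: `(A - Q)Q = (Q(A - Q))*`.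
  have h1 : IsHilbertSchmidt b ((A - Q) ∘L Q) := by
    have h2 := (h.comp_left Q).adjoint
    rwa [ContinuousLinearMap.adjoint_comp, ← ContinuousLinearMap.star_eq_adjoint,
      ← ContinuousLinearMap.star_eq_adjoint, (hA.sub hQ.isSelfAdjoint).star_eq,
      hQ.isSelfAdjoint.star_eq] at h2
  have h3 := ((h.comp_left A).add h1).add h.neg
  have hQQ : Q * Q = Q := hQ.isIdempotentElem
  convert h3 using 1
  change A * A - A = A * (A - Q) + (A - Q) * Q + -(A - Q)
  rw [mul_sub, sub_mul, hQQ]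
  abel

/-- If `F - X` is Hilbert–Schmidt, then so is `F* F - X* X`. -/
theorem IsHilbertSchmidt.adjoint_comp_self_sub [CompleteSpace E] [CompleteSpace G]
    {b : HilbertBasis ι ℂ E} {F X : E →L[ℂ] G} (h : IsHilbertSchmidt b (F - X)) :
    IsHilbertSchmidt b (ContinuousLinearMap.adjoint F ∘L F - ContinuousLinearMap.adjoint X ∘L X) := by
  -- `F*F - X*X = F*(F - X) + (X*(F - X))*`.
  have h1 := (h.comp_left (ContinuousLinearMap.adjoint F)).add
    (h.comp_left (ContinuousLinearMap.adjoint X)).adjoint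
  convert h1 using 1
  rw [ContinuousLinearMap.adjoint_comp, ContinuousLinearMap.adjoint_adjoint]
  ext x
  simp [map_sub]

end HilbertSchmidtIdeal

/-! ### The index of a projection with itself. -/

section SelfPair

variable {E : Type*} [NormedAddCommGroup E] [InnerProductSpace ℂ E]

theorem isFredholmPairOfIndex_self {P : E →L[ℂ] E} (hP : IsIdempotentElem P) :
    IsFredholmPairOfIndex P P 0 := by
  have h : pairOperator P P = ContinuousLinearMap.id ℂ P.range := by
    ext ⟨_, x, rfl⟩
    have h1 : ∀ z, P (P z) = P z := fun z => congrArg (fun T : E →L[ℂ] E => T z) hP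
    change P (P (P x)) = P x
    rw [h1, h1]
  unfold IsFredholmPairOfIndex
  rw [h]
  exact ⟨.of_isQuasiInverse (v := ContinuousLinearMap.id ℂ P.range)
    (LinearEquiv.refl ℂ P.range).isQuasiInverse, LinearMap.index_id⟩

end SelfPair

/-! ### From closeness to a Parseval frame to `|F| - P` Hilbert–Schmidt. -/

section ClosedRange

variable {ι E H : Type*}
  [NormedAddCommGroup E] [InnerProductSpace ℂ E] [CompleteSpace E]
  [NormedAddCommGroup H] [InnerProductSpace ℂ H] [CompleteSpace H]

/-- If `F` has closed range and is Hilbert–Schmidt close to some operator `X` for which `X* X` is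
a projection, then `|F|` is Hilbert–Schmidt close to the projection onto `(ker F)ᗮ`. -/
theorem isHilbertSchmidt_modulus_sub {b : HilbertBasis ι ℂ E} {F X : E →L[ℂ] H} {c : ℝ}
    (hc : 0 < c) (hF : ∀ x ∈ (F.ker)ᗮ, c * ‖x‖ ≤ ‖F x‖)
    (hX : IsStarProjection (adjoint X ∘L X)) (h : IsHilbertSchmidt b (F - X)) :
    IsHilbertSchmidt b (modulus F - (F.ker)ᗮ.starProjection) := by
  have hA : IsSelfAdjoint (adjoint F ∘L F) :=
    (ContinuousLinearMap.isPositive_adjoint_comp_self F).isSelfAdjoint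
  have h1 := h.adjoint_comp_self_sub.sq_sub_self hA hX
  rw [← modulus_comp_modulus] at h1
  -- `|F|²` is bounded below by `c²` on `(ker F)ᗮ`: the bound for `F` is used at `|F|x` and at `x`.
  have hlow : ∀ x ∈ (F.ker)ᗮ, c ^ 2 * ‖x‖ ≤ ‖modulus F (modulus F x)‖ := fun x hx => by
    have h2 := hF _ (modulus_apply_mem F x)
    rw [norm_modulus_apply] at h2 ⊢
    have h3 := mul_le_mul_of_nonneg_left (hF x hx) hc.le
    linarith
  refine Summable.of_nonneg_of_le (fun _ => by positivity) (fun i => ?_)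
    (h1.mul_left ((c ^ 2)⁻¹ ^ 2))
  rw [← mul_pow]
  refine pow_le_pow_left₀ (norm_nonneg _) ?_ 2
  set x := b i
  set y := modulus F x - (F.ker)ᗮ.starProjection x with hy
  have hyM : y ∈ (F.ker)ᗮ :=
    sub_mem (modulus_apply_mem F x) (Submodule.starProjection_apply_mem _ x)
  have h4 := hlow _ (add_mem (modulus_apply_mem F y) hyM)
  have h5 := norm_le_norm_add_of_nonneg (modulus_nonneg F) y
  -- The factorization `|F|²(|F| + 1)(|F| - P) = |F|⁴ - |F|²` at `x`.
  have h6 : modulus F (modulus F (modulus F y + y)) =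
      ((modulus F ∘L modulus F) ∘L (modulus F ∘L modulus F) - modulus F ∘L modulus F) x := by
    have h7 : modulus F y + y = modulus F (modulus F x) - (F.ker)ᗮ.starProjection x := by
      rw [hy, map_sub, modulus_apply_starProjection]
      abel
    rw [h7, map_sub, map_sub, modulus_apply_starProjection]
    rfl
  rw [h6] at h4
  change ‖y‖ ≤ _
  rw [inv_mul_eq_div, le_div_iff₀ (by positivity)]
  have := mul_le_mul_of_nonneg_left h5 (sq_nonneg c)
  linarith

theorem sub_polarFactor_eq (F : E →L[ℂ] H) :
    F - polarFactor F = polarFactor F ∘L (modulus F - (F.ker)ᗮ.starProjection) := by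
  ext x
  have h : x - (F.ker)ᗮ.starProjection x ∈ (polarFactor F).ker := by
    have h1 := Submodule.sub_starProjection_mem_orthogonal (K := (F.ker)ᗮ) x
    rw [Submodule.orthogonal_orthogonal] at h1
    exact (polarFactor_spec F).ker_eq.symm ▸ h1
  have h2 : polarFactor F (x - (F.ker)ᗮ.starProjection x) = 0 := h
  rw [map_sub, sub_eq_zero] at h2
  rw [ContinuousLinearMap.comp_apply, sub_apply, sub_apply, map_sub, polarFactor_modulus_apply,
    ← h2]

/-- If `U` is a partial isometry, then `U U*` is a projection. -/
theorem isStarProjection_comp_adjoint {U : E →L[ℂ] H} (hU : ∀ x ∈ (U.ker)ᗮ, ‖U x‖ = ‖x‖) :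
    IsStarProjection (U ∘L adjoint U) := by
  have h1 : ∀ x, U (adjoint U (U x)) = U x := fun x => by
    have h2 : adjoint U (U x) = (U.ker)ᗮ.starProjection x :=
      congrArg (fun T : E →L[ℂ] E => T x) (adjoint_comp_self_of_isometric hU)
    have h3 : x - (U.ker)ᗮ.starProjection x ∈ U.ker := by
      have h4 := Submodule.sub_starProjection_mem_orthogonal (K := (U.ker)ᗮ) x
      rwa [Submodule.orthogonal_orthogonal] at h4
    have h4 : U (x - (U.ker)ᗮ.starProjection x) = 0 := h3
    rw [map_sub, sub_eq_zero] at h4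
    rw [h2, ← h4]
  refine ⟨?_, ?_⟩
  · ext x
    exact h1 _
  · have := (ContinuousLinearMap.isPositive_adjoint_comp_self (adjoint U)).isSelfAdjoint
    rwa [ContinuousLinearMap.adjoint_adjoint] at this

end ClosedRange

/-! ### Translation from frames to synthesis operators. -/

section Frames

variable {H : Type*} [NormedAddCommGroup H] [InnerProductSpace ℂ H]

/-- The standard basis of `ℓ²`. -/
noncomputable def standardBasis : HilbertBasis ℕ ℂ ℓ²(ℕ, ℂ) :=
  HilbertBasis.ofRepr (LinearIsometryEquiv.refl ℂ _)

theorem standardBasis_apply (i : ℕ) : standardBasis i = lp.single 2 i (1 : ℂ) := by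
  rw [← HilbertBasis.repr_symm_single]
  rfl

theorem IsSynthesis.apply_standardBasis {f : ℕ → H} {F : ℓ²(ℕ, ℂ) →L[ℂ] H} (hF : IsSynthesis f F)
    (i : ℕ) : F (standardBasis i) = f i := by
  rw [standardBasis_apply, hF]

theorem IsSynthesis.tsum_ofReal {f x : ℕ → H} {F X : ℓ²(ℕ, ℂ) →L[ℂ] H} (hF : IsSynthesis f F)
    (hX : IsSynthesis x X) (h : QuadraticallyClose f x) :
    ∑' i, ENNReal.ofReal (‖(F - X) (standardBasis i)‖ ^ 2) =
      ENNReal.ofReal (∑' i, ‖f i - x i‖ ^ 2) := by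
  rw [ENNReal.ofReal_tsum_of_nonneg (fun _ => by positivity) h]
  simp only [sub_apply, hF.apply_standardBasis, hX.apply_standardBasis]

variable [CompleteSpace H]

theorem IsSynthesis.hasSum {f : ℕ → H} {F : ℓ²(ℕ, ℂ) →L[ℂ] H} (hF : IsSynthesis f F) (y : H) :
    HasSum (fun i => ‖⟪y, f i⟫_ℂ‖ ^ 2) (‖adjoint F y‖ ^ 2) := by
  have h := hasSum_norm_inner_sq standardBasis (adjoint F y)
  simp only [ContinuousLinearMap.adjoint_inner_right, hF.apply_standardBasis] at h
  simpa only [norm_inner_symm] using h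

theorem IsSynthesis.adjoint_apply_eq_zero {f : ℕ → H} {F : ℓ²(ℕ, ℂ) →L[ℂ] H}
    (hF : IsSynthesis f F) {K : Submodule ℂ H} (hK : ∀ i, f i ∈ K) {y : H} (hy : y ∈ Kᗮ) :
    adjoint F y = 0 := by
  have h := hF.hasSum y
  have h0 : ∀ i, ⟪y, f i⟫_ℂ = 0 := fun i => (Submodule.mem_orthogonal' _ _).1 hy _ (hK i)
  simp only [h0, norm_zero, ne_eq, OfNat.ofNat_ne_zero, not_false_eq_true, zero_pow] at h
  exact norm_eq_zero.1 (pow_eq_zero_iff two_ne_zero |>.1 (h.unique hasSum_zero))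

/-- The Parseval identity makes `X*` isometric on `L`, which contains `(ker X*)ᗮ`; so `X*` is a
partial isometry. -/
theorem IsParsevalFrameIn.isStarProjection {x : ℕ → H} {L : Submodule ℂ H}
    (hx : IsParsevalFrameIn L x) : IsStarProjection (adjoint (synthesis x) ∘L synthesis x) := by
  have hX := hx.isFrameIn.isSynthesis
  have : CompleteSpace L := hx.isClosed.completeSpace_coe
  have hL : ((adjoint (synthesis x)).ker)ᗮ ≤ L := by
    rw [← Submodule.orthogonal_orthogonal L]
    exact Submodule.orthogonal_le fun y hy => hX.adjoint_apply_eq_zero hx.mem hy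
  have h := isStarProjection_comp_adjoint (U := adjoint (synthesis x)) fun y hy => by
    have h1 := (hX.hasSum y).unique (hx.parseval y (hL hy))
    exact (sq_eq_sq₀ (norm_nonneg _) (norm_nonneg _)).1 h1
  rwa [ContinuousLinearMap.adjoint_adjoint] at h

/-- The frame bound gives `‖F*z‖ ≥ √A ‖z‖` on `K`. For `w = F*z`, `‖w‖² = ⟪z, F w⟫ ≤ ‖z‖ ‖F w‖`,
hence `√A ‖w‖ ≤ ‖F w‖`; such `w` are dense in `(ker F)ᗮ`. -/
theorem IsFrameIn.exists_lower_bound {f : ℕ → H} {K : Submodule ℂ H} (hf : IsFrameIn K f) :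
    ∃ c : ℝ, 0 < c ∧ ∀ x ∈ ((synthesis f).ker)ᗮ, c * ‖x‖ ≤ ‖synthesis f x‖ := by
  obtain ⟨A, B, hA, -, hAB⟩ := hf.bounds
  have hF := hf.isSynthesis
  have : CompleteSpace K := hf.isClosed.completeSpace_coe
  refine ⟨√A, Real.sqrt_pos.2 hA, fun x hx => ?_⟩
  rw [ContinuousLinearMap.orthogonal_ker] at hx
  have hcl : IsClosed {x | √A * ‖x‖ ≤ ‖synthesis f x‖} :=
    isClosed_le (by fun_prop) (by fun_prop)
  refine closure_minimal ?_ hcl hx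
  rintro _ ⟨y, rfl⟩
  change √A * ‖adjoint (synthesis f) y‖ ≤ ‖synthesis f (adjoint (synthesis f) y)‖
  set z := K.starProjection y with hz
  have h1 : adjoint (synthesis f) y = adjoint (synthesis f) z := by
    rw [← sub_eq_zero, ← map_sub]
    exact hF.adjoint_apply_eq_zero hf.mem (Submodule.sub_starProjection_mem_orthogonal y)
  rw [h1]
  set w := adjoint (synthesis f) z with hw
  have h2 : √A * ‖z‖ ≤ ‖w‖ := by
    refine le_of_sq_le_sq ?_ (norm_nonneg _)
    rw [mul_pow, Real.sq_sqrt hA.le, ← (hF.hasSum z).tsum_eq]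
    exact (hAB z (Submodule.starProjection_apply_mem _ y)).2.1
  have h3 : ‖w‖ * ‖w‖ ≤ ‖z‖ * ‖synthesis f w‖ := by
    have h4 := re_inner_le_norm (𝕜 := ℂ) z (synthesis f w)
    rwa [← ContinuousLinearMap.adjoint_inner_left, ← hw, inner_self_eq_norm_mul_norm] at h4
  rcases (norm_nonneg w).eq_or_lt with h0 | h0
  · rw [← h0, mul_zero]
    exact norm_nonneg _
  · refine le_of_mul_le_mul_right ?_ h0
    calc √A * ‖w‖ * ‖w‖ = √A * (‖w‖ * ‖w‖) := by ring
      _ ≤ √A * (‖z‖ * ‖synthesis f w‖) := by gcongr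
      _ = √A * ‖z‖ * ‖synthesis f w‖ := by ring
      _ ≤ ‖w‖ * ‖synthesis f w‖ := by gcongr
      _ = ‖synthesis f w‖ * ‖w‖ := by ring

theorem isSynthesis_canonicalParseval (f : ℕ → H) :
    IsSynthesis (canonicalParseval f) (polarFactor (synthesis f)) := fun _ => rfl

theorem isStarProjection_adjoint_polarFactor {E : Type*} [NormedAddCommGroup E]
    [InnerProductSpace ℂ E] [CompleteSpace E] (F : E →L[ℂ] H) :
    IsStarProjection (adjoint (polarFactor F) ∘L polarFactor F) := by
  rw [adjoint_polarFactor_comp_polarFactor]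
  exact isStarProjection_starProjection

theorem isParsevalFrameIn_canonicalParseval (f : ℕ → H) :
    IsParsevalFrameIn (polarFactor (synthesis f)).range.topologicalClosure
      (canonicalParseval f) where
  isClosed := Submodule.isClosed_topologicalClosure _
  mem i := Submodule.le_topologicalClosure _ ⟨_, rfl⟩
  parseval y hy := by
    have h : ‖adjoint (polarFactor (synthesis f)) y‖ = ‖y‖ := by
      have hcl : IsClosed {y | ‖adjoint (polarFactor (synthesis f)) y‖ = ‖y‖} :=
        isClosed_eq (by fun_prop) (by fun_prop)
      refine closure_minimal ?_ hcl hy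
      rintro _ ⟨z, rfl⟩
      -- On the range, `‖U*Uz‖ = ‖Uz‖` because `U*U` is a projection; continuity covers the closure.
      exact norm_adjoint_comp_self_apply (isStarProjection_adjoint_polarFactor _) z
    rw [← h]
    exact (isSynthesis_canonicalParseval f).hasSum y

theorem synthesis_canonicalParseval (f : ℕ → H) :
    synthesis (canonicalParseval f) = polarFactor (synthesis f) :=
  (isParsevalFrameIn_canonicalParseval f).isFrameIn.isSynthesis.eq
    (isSynthesis_canonicalParseval f)

theorem IsFrameIn.isHilbertSchmidt_modulus_sub {f : ℕ → H} {K : Submodule ℂ H}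
    (hf : IsFrameIn K f) (hclose : (closeParsevalFrames f).Nonempty) :
    IsHilbertSchmidt standardBasis
      (modulus (synthesis f) - ((synthesis f).ker)ᗮ.starProjection) := by
  obtain ⟨x, ⟨L, hx⟩, hfx⟩ := hclose
  obtain ⟨c, hc, hlow⟩ := hf.exists_lower_bound
  refine FrameApprox.isHilbertSchmidt_modulus_sub hc hlow hx.isStarProjection ?_
  refine hfx.congr fun i => ?_
  rw [sub_apply, hf.isSynthesis.apply_standardBasis, hx.isFrameIn.isSynthesis.apply_standardBasis]

theorem IsFrameIn.quadraticallyClose_canonicalParseval {f : ℕ → H} {K : Submodule ℂ H}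
    (hf : IsFrameIn K f) (hclose : (closeParsevalFrames f).Nonempty) :
    QuadraticallyClose f (canonicalParseval f) := by
  have h := (hf.isHilbertSchmidt_modulus_sub hclose).comp_left (polarFactor (synthesis f))
  rw [← sub_polarFactor_eq] at h
  refine h.congr fun i => ?_
  rw [sub_apply, hf.isSynthesis.apply_standardBasis,
    (isSynthesis_canonicalParseval f).apply_standardBasis]

end Frames

end FrameApprox

theorem theorem4p5 {H : Type*} [NormedAddCommGroup H] [InnerProductSpace ℂ H] [CompleteSpace H]
    [TopologicalSpace.SeparableSpace H] (hH : ¬ FiniteDimensional ℂ H)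
    (K : Submodule ℂ H) (f : ℕ → H) (hf : FrameApprox.IsFrameIn K f)
    (hclose : (FrameApprox.closeParsevalFrames f).Nonempty) :
    FrameApprox.canonicalParseval f ∈ FrameApprox.closeParsevalFramesOfIndex f 0 ∧
    ∀ x ∈ FrameApprox.closeParsevalFramesOfIndex f 0,
      ∑' i, ‖f i - FrameApprox.canonicalParseval f i‖ ^ 2 ≤ ∑' i, ‖f i - x i‖ ^ 2 ∧
      (∑' i, ‖f i - FrameApprox.canonicalParseval f i‖ ^ 2 = ∑' i, ‖f i - x i‖ ^ 2 ↔
        x = FrameApprox.canonicalParseval f) := by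
  open FrameApprox in
  have hfu := hf.quadraticallyClose_canonicalParseval hclose
  have hU := isSynthesis_canonicalParseval f
  refine ⟨⟨⟨⟨_, isParsevalFrameIn_canonicalParseval f⟩, hfu⟩, ?_⟩, ?_⟩
  · rw [synthesis_canonicalParseval]
    exact isFredholmPairOfIndex_self (isStarProjection_adjoint_polarFactor _).isIdempotentElem
  rintro x ⟨⟨⟨L, hx⟩, hfx⟩, hind⟩
  have hX := hx.isFrameIn.isSynthesis
  have hcpt := isCompactOperator_of_summable_norm_sq _ _
    (hf.isHilbertSchmidt_modulus_sub hclose)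
  obtain ⟨hle, heq⟩ := polarFactor_closest hcpt hx.isStarProjection hind standardBasis
  rw [hf.isSynthesis.tsum_ofReal hU hfu, hf.isSynthesis.tsum_ofReal hX hfx] at hle heq
  refine ⟨(ENNReal.ofReal_le_ofReal_iff (tsum_nonneg fun _ => by positivity)).1 hle,
    fun h => ?_, fun h => by rw [h]⟩
  have hXU := heq ENNReal.ofReal_ne_top (by rw [h])
  ext i
  rw [← hX i, hXU, hU i]
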